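/- Let $\mathcal P$ be a filtered poset, that is, a partially ordered set for which there exists a strictly order-preserving map $d\colon \mathcal P\to\mathbb N$. Let $R$ be a unital commutative ring and let $F\colon \mathcal P^{\mathrm{op}}\to R\text{-}\mathrm{Mod}$ be a functor, where $\mathcal P$ is regarded as a category with a single arrow $p\to q$ whenever $p\le q$. For a poset $\mathcal Q$ and a functor $G\colon\mathcal Q^{\mathrm{op}}\to R\text{-}\mathrm{Mod}$, denote by $H^k(\mathcal Q;G)$, $k\ge 0$, the higher limits of $G$, i.e. the value at $G$ of the $k$-th right derived functor of $\lim\colon \mathrm{Fun}(\mathcal Q^{\mathrm{op}},R\text{-}\mathrm{Mod})\to R\text{-}\mathrm{Mod}$. For $p\in\mathcal P$ let $\mathcal P_{<p}=\{q\in\mathcal P\mid q<p\}$ and write $H^k(\mathcal P_{<p};F)$ for $H^k(\mathcal P_{<p};F|_{\mathcal P_{<p}})$. Let $n\ge 0$ be an integer. If for every $p\in\mathcal P$ we have $H^k(\mathcal P_{<p};F)=0$ for all $k\ge n$, then $$H^k(\mathcal P;F)=0\quad\text{for all } k>n.$$ -/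

import Mathlib

open CategoryTheory CategoryTheory.Limits

universe w v u

/-- A poset is filtered if it admits a strictly order-preserving map `d : P → ℕ`
(this is not the categorical notion of being filtered, i.e. directed). -/
def IsFilteredPoset (P : Type v) [PartialOrder P] : Prop :=
  ∃ d : P → ℕ, StrictMono d

section HigherLimits

variable (P : Type v) [PartialOrder P] [Small.{w} P] (R : Type u) [CommRing R] [Small.{w} R]

instance hasLimitsOfShape_op_poset : HasLimitsOfShape Pᵒᵖ (ModuleCat.{w} R) :=
  have : Small.{w} Pᵒᵖ := small_of_injective (f := Opposite.unop) Opposite.unop_injective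
  ModuleCat.hasLimitsOfShape

theorem isGrothendieckAbelian_moduleCat_of_small : IsGrothendieckAbelian.{w} (ModuleCat.{w} R) :=
  IsGrothendieckAbelian.of_equivalence
    (ModuleCat.restrictScalars (equivShrink.{w} R).symm.ringEquiv.toRingHom).asEquivalence.symm

/-- The category of contravariant functors from a poset to `R`-modules has enough injectives,
so that right derived functors are defined on it. -/
instance enoughInjectives_poset_functor : EnoughInjectives (Pᵒᵖ ⥤ ModuleCat.{w} R) := by
  have := isGrothendieckAbelian_moduleCat_of_small.{w} R
  have : EnoughInjectives ((SmallModel.{w} P)ᵒᵖ ⥤ ModuleCat.{w} R) :=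
    EnoughInjectives.of_equivalence
      (sheafBotEquivalence (C := SmallModel.{w} P) (ModuleCat.{w} R)).inverse
  exact EnoughInjectives.of_equivalence
    ((equivSmallModel.{w} P).op.congrLeft (E := ModuleCat.{w} R)).functor

instance lim_additive_poset : (lim : (Pᵒᵖ ⥤ ModuleCat.{w} R) ⥤ ModuleCat.{w} R).Additive :=
  constLimAdj.right_adjoint_additive

variable {P R}

/-- `H^k(P; F)`: the `k`-th right derived functor of
`lim : Fun(Pᵒᵖ, R-Mod) ⥤ R-Mod`, evaluated at `F`. -/
noncomputable def higherLimit (F : Pᵒᵖ ⥤ ModuleCat.{w} R) (k : ℕ) : ModuleCat.{w} R :=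
  ((lim : (Pᵒᵖ ⥤ ModuleCat.{w} R) ⥤ ModuleCat.{w} R).rightDerived k).obj F

/-- The restriction of `F` to the subposet `P_{<p} = {q | q < p}`. -/
def restrictIio (F : Pᵒᵖ ⥤ ModuleCat.{w} R) (p : P) : (Set.Iio p)ᵒᵖ ⥤ ModuleCat.{w} R :=
  (Subtype.mono_coe (· ∈ Set.Iio p)).functor.op ⋙ F

end HigherLimits

/-! Compute higher limits by sections of an injective resolution `I` of `F`. A global cocycle `z` of
degree `k + 1` has a primitive at each point, because exactness is pointwise; well-founded recursion
makes these primitives compatible. Given compatible primitives `t` below `p` and any primitive `e`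
of `z` at `p`, the difference `e - t` is a `k`-cocycle over `P_{<p}`. Vanishing of `H^k(P_{<p}; F)`
lets it extend to a cocycle `u'` at `p` (`exists_cocycle_extension`), and `e - u'` continues `t`.
The extension rests on extension by zero from a lower set, a mono-preserving left adjoint of
restriction with monic counit: restriction keeps injectives injective, and sections of an injective
presheaf over a lower set extend globally. -/

/-! ### Extension by zero from lower sets -/

section ExtensionByZero

variable {P : Type v} [PartialOrder P] {R : Type u} [CommRing R]

/-- Restriction of presheaves of modules on a poset to a subset. -/
abbrev presheafRestrict (R : Type u) [CommRing R] (D : Set P) :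
    (Pᵒᵖ ⥤ ModuleCat.{w} R) ⥤ (Dᵒᵖ ⥤ ModuleCat.{w} R) :=
  (Functor.whiskeringLeft _ _ _).obj (Subtype.mono_coe (· ∈ D)).functor.op

variable {D : Set P}

/-- A morphism of the opposite of a poset between elements of a subset. -/
abbrev subsetOpHom {p q : Pᵒᵖ} (f : p ⟶ q) (hp : p.unop ∈ D) (hq : q.unop ∈ D) :
    (Opposite.op ⟨p.unop, hp⟩ : Dᵒᵖ) ⟶ .op ⟨q.unop, hq⟩ :=
  (homOfLE (show (⟨q.unop, hq⟩ : D) ≤ ⟨p.unop, hp⟩ from leOfHom f.unop)).op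

open Classical in
/-- Extension by zero of a presheaf of modules from a lower set to the whole poset. The value at
`p` is the module of functions from proofs of `p ∈ D`, so it vanishes outside `D`. -/
noncomputable def extendByZero (hD : IsLowerSet D) (X : Dᵒᵖ ⥤ ModuleCat.{w} R) :
    Pᵒᵖ ⥤ ModuleCat.{w} R where
  obj p := ModuleCat.of R (∀ h : PLift (p.unop ∈ D), X.obj (.op ⟨p.unop, h.down⟩))
  map {p q} f := ModuleCat.ofHom <| LinearMap.pi fun hq ↦
    if hp : p.unop ∈ D then
      (X.map (subsetOpHom f hp hq.down)).hom ∘ₗ LinearMap.proj (PLift.up hp)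
    else 0
  map_id p := by
    refine ModuleCat.hom_ext (LinearMap.ext fun x ↦ funext fun hp ↦ ?_)
    have := hp.down
    simp only [this, dite_true]
    exact ConcreteCategory.congr_hom (X.map_id _) _
  map_comp {p q r} f g := by
    refine ModuleCat.hom_ext (LinearMap.ext fun x ↦ funext fun hr ↦ ?_)
    by_cases hp : p.unop ∈ D
    · have hq : q.unop ∈ D := hD (leOfHom f.unop) hp
      simp only [hp, hq, dite_true, ModuleCat.hom_comp, ModuleCat.hom_ofHom, LinearMap.comp_apply,
        LinearMap.pi_apply, LinearMap.proj_apply]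
      rw [← LinearMap.comp_apply, ← ModuleCat.hom_comp, ← X.map_comp]
      rfl
    · by_cases hq : q.unop ∈ D
      · simp only [hp, hq, dite_true, dite_false]
        exact (map_zero (X.map (subsetOpHom g hq hr.down)).hom).symm
      · simp only [hp, hq, dite_false]
        rfl

theorem extendByZero_map_apply (hD : IsLowerSet D) (X : Dᵒᵖ ⥤ ModuleCat.{w} R) {p q : Pᵒᵖ}
    (f : p ⟶ q) (x : (extendByZero hD X).obj p) (hq : PLift (q.unop ∈ D)) (hp : p.unop ∈ D) :
    ((extendByZero hD X).map f).hom x hq = X.map (subsetOpHom f hp hq.down) (x ⟨hp⟩) := by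
  simp only [extendByZero, hp, dite_true]
  rfl

theorem extendByZero_map_apply_of_notMem (hD : IsLowerSet D) (X : Dᵒᵖ ⥤ ModuleCat.{w} R)
    {p q : Pᵒᵖ} (f : p ⟶ q) (x : (extendByZero hD X).obj p) (hq : PLift (q.unop ∈ D))
    (hp : p.unop ∉ D) : ((extendByZero hD X).map f).hom x hq = 0 := by
  simp only [extendByZero, hp, dite_false]
  rfl

/-- Functoriality of extension by zero. -/
noncomputable def extendByZeroMap (hD : IsLowerSet D) {X Y : Dᵒᵖ ⥤ ModuleCat.{w} R} (φ : X ⟶ Y) :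
    extendByZero hD X ⟶ extendByZero hD Y where
  app p := ModuleCat.ofHom <| LinearMap.pi fun h ↦
    (φ.app (.op ⟨p.unop, h.down⟩)).hom ∘ₗ LinearMap.proj h
  naturality p q f := by
    refine ModuleCat.hom_ext (LinearMap.ext fun x ↦ funext fun hq ↦ ?_)
    by_cases hp : p.unop ∈ D
    · refine Eq.trans ?_ (extendByZero_map_apply hD Y f _ hq hp).symm
      refine (congr_arg (φ.app _) (extendByZero_map_apply hD X f x hq hp)).trans ?_
      exact NatTrans.naturality_apply φ _ _
    · refine Eq.trans ?_ (extendByZero_map_apply_of_notMem hD Y f _ hq hp).symm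
      refine (congr_arg (φ.app _) (extendByZero_map_apply_of_notMem hD X f x hq hp)).trans ?_
      exact map_zero _

/-- Extension by zero along a lower set, as a functor. -/
noncomputable def extendByZeroFunctor (R : Type u) [CommRing R] (hD : IsLowerSet D) :
    (Dᵒᵖ ⥤ ModuleCat.{w} R) ⥤ (Pᵒᵖ ⥤ ModuleCat.{w} R) where
  obj X := extendByZero hD X
  map φ := extendByZeroMap hD φ

instance (hD : IsLowerSet D) : (extendByZeroFunctor.{w} R hD).PreservesMonomorphisms where
  preserves {X Y} φ hφ := by
    have (p : Pᵒᵖ) : Mono (((extendByZeroFunctor R hD).map φ).app p) := by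
      rw [ModuleCat.mono_iff_injective]
      intro x y hxy
      funext h
      have := (NatTrans.mono_iff_mono_app φ).1 hφ (.op ⟨p.unop, h.down⟩)
      exact (ModuleCat.mono_iff_injective _).1 this (congr_fun hxy h)
    exact NatTrans.mono_of_mono_app _

open Classical in
/-- The components of the comparison map from the extension by zero of the restriction. -/
noncomputable def extendByZeroCounitApp (hD : IsLowerSet D) (G : Pᵒᵖ ⥤ ModuleCat.{w} R)
    (p : Pᵒᵖ) : (extendByZero hD ((presheafRestrict R D).obj G)).obj p ⟶ G.obj p :=
  if hp : p.unop ∈ D then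
    ModuleCat.ofHom (X := ∀ _ : PLift (p.unop ∈ D), G.obj p) (Y := G.obj p) (LinearMap.proj ⟨hp⟩)
  else 0

theorem extendByZeroCounitApp_apply (hD : IsLowerSet D) (G : Pᵒᵖ ⥤ ModuleCat.{w} R) {p : Pᵒᵖ}
    (hp : p.unop ∈ D) (x : (extendByZero hD ((presheafRestrict R D).obj G)).obj p) :
    (extendByZeroCounitApp hD G p).hom x = x ⟨hp⟩ :=
  ConcreteCategory.congr_hom (dif_pos hp : extendByZeroCounitApp hD G p = _) x

theorem extendByZeroCounitApp_apply_of_notMem (hD : IsLowerSet D) (G : Pᵒᵖ ⥤ ModuleCat.{w} R)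
    {p : Pᵒᵖ} (hp : p.unop ∉ D) (x : (extendByZero hD ((presheafRestrict R D).obj G)).obj p) :
    (extendByZeroCounitApp hD G p).hom x = 0 :=
  ConcreteCategory.congr_hom (dif_neg hp : extendByZeroCounitApp hD G p = _) x

/-- The comparison map from the extension by zero of the restriction of a presheaf. -/
noncomputable def extendByZeroCounit (hD : IsLowerSet D) (G : Pᵒᵖ ⥤ ModuleCat.{w} R) :
    extendByZero hD ((presheafRestrict R D).obj G) ⟶ G where
  app p := extendByZeroCounitApp hD G p
  naturality p q f := by
    refine ModuleCat.hom_ext (LinearMap.ext fun x ↦ ?_)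
    by_cases hp : p.unop ∈ D
    · have hq : q.unop ∈ D := hD (leOfHom f.unop) hp
      refine (extendByZeroCounitApp_apply hD G hq _).trans ?_
      refine (extendByZero_map_apply hD _ f x ⟨hq⟩ hp).trans ?_
      exact congr_arg (G.map f) (extendByZeroCounitApp_apply hD G hp x).symm
    · refine Eq.trans ?_ ((congr_arg (G.map f)
        (extendByZeroCounitApp_apply_of_notMem hD G hp x)).trans (map_zero _)).symm
      by_cases hq : q.unop ∈ D
      · exact (extendByZeroCounitApp_apply hD G hq _).trans
          (extendByZero_map_apply_of_notMem hD _ f x ⟨hq⟩ hp)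
      · exact extendByZeroCounitApp_apply_of_notMem hD G hq _

/-- The comparison map is bijective over `D`, and its source vanishes off `D`. -/
theorem mono_extendByZeroCounit (hD : IsLowerSet D) (G : Pᵒᵖ ⥤ ModuleCat.{w} R) :
    Mono (extendByZeroCounit hD G) := by
  have (p : Pᵒᵖ) : Mono ((extendByZeroCounit hD G).app p) := by
    rw [ModuleCat.mono_iff_injective]
    intro x y hxy
    funext h
    exact (extendByZeroCounitApp_apply hD G h.down x).symm.trans
      (Eq.trans hxy (extendByZeroCounitApp_apply hD G h.down y))
  exact NatTrans.mono_of_mono_app _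

/-- Extension by zero along a lower set is left adjoint to restriction. -/
noncomputable def extendByZeroAdjunction (R : Type u) [CommRing R] (hD : IsLowerSet D) :
    extendByZeroFunctor.{w} R hD ⊣ presheafRestrict.{w} R D where
  unit :=
    { app X :=
        { app p := ModuleCat.ofHom (LinearMap.pi fun _ ↦ LinearMap.id)
          naturality p q f := by
            refine ModuleCat.hom_ext (LinearMap.ext fun x ↦ funext fun hq ↦ ?_)
            exact (extendByZero_map_apply hD X
              ((Subtype.mono_coe (· ∈ D)).functor.op.map f) (fun _ ↦ x) hq p.unop.2).symm } }
  counit :=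
    { app G := extendByZeroCounit hD G
      naturality G G' φ := by
        refine NatTrans.ext (funext fun p ↦ ModuleCat.hom_ext (LinearMap.ext fun x ↦ ?_))
        by_cases hp : p.unop ∈ D
        · refine (extendByZeroCounitApp_apply hD G' hp _).trans ?_
          exact congr_arg (φ.app p) (extendByZeroCounitApp_apply hD G hp x).symm
        · refine (extendByZeroCounitApp_apply_of_notMem hD G' hp _).trans ?_
          exact ((congr_arg (φ.app p)
            (extendByZeroCounitApp_apply_of_notMem hD G hp x)).trans (map_zero _)).symm }
  left_triangle_components X := by
    refine NatTrans.ext (funext fun p ↦ ModuleCat.hom_ext (LinearMap.ext fun x ↦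
      funext fun h ↦ ?_))
    exact congr_fun (extendByZeroCounitApp_apply hD (extendByZero hD X) h.down _) h
  right_triangle_components G := by
    refine NatTrans.ext (funext fun p ↦ ModuleCat.hom_ext (LinearMap.ext fun x ↦ ?_))
    exact extendByZeroCounitApp_apply hD G p.unop.2 _

/-- A map between restrictions to a lower set extends, if the target is injective. -/
theorem exists_presheafRestrict_map_eq (hD : IsLowerSet D) {G E : Pᵒᵖ ⥤ ModuleCat.{w} R}
    [Injective E] (ψ : (presheafRestrict R D).obj G ⟶ (presheafRestrict R D).obj E) :
    ∃ φ : G ⟶ E, (presheafRestrict R D).map φ = ψ := by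
  let adj := extendByZeroAdjunction.{w} R hD
  have : Mono (adj.counit.app G) := mono_extendByZeroCounit hD G
  refine ⟨Injective.factorThru ((adj.homEquiv _ _).symm ψ) (adj.counit.app G), ?_⟩
  apply (adj.homEquiv _ _).symm.injective
  refine Eq.trans ?_ (Injective.comp_factorThru ((adj.homEquiv _ _).symm ψ) (adj.counit.app G))
  rw [Adjunction.homEquiv_counit]
  exact adj.counit_naturality _

end ExtensionByZero

/-! ### Sections and elements of limits -/

section Sections

variable {P : Type v} [PartialOrder P] {R : Type u} [CommRing R]

/-- A family of elements of the values of a presheaf is a section if it is compatible with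
restriction. -/
def IsSection (G : Pᵒᵖ ⥤ ModuleCat.{w} R) (x : ∀ p, G.obj p) : Prop :=
  ∀ ⦃p q : Pᵒᵖ⦄ (f : p ⟶ q), G.map f (x p) = x q

theorem IsSection.map {G H : Pᵒᵖ ⥤ ModuleCat.{w} R} {x : ∀ p, G.obj p} (hx : IsSection G x)
    (φ : G ⟶ H) : IsSection H fun p ↦ φ.app p (x p) := fun p q f ↦ by
  dsimp only
  rw [← hx f]
  exact (NatTrans.naturality_apply φ f _).symm

theorem isSection_of_lt {G : Pᵒᵖ ⥤ ModuleCat.{w} R} {x : ∀ p, G.obj p}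
    (h : ∀ (p q : P) (hq : q < p), G.map (homOfLE hq.le).op (x (.op p)) = x (.op q)) :
    IsSection G x := fun p q f ↦ by
  rcases (leOfHom f.unop).eq_or_lt with hpq | hpq
  · obtain rfl : q = p := Opposite.unop_injective hpq
    rw [Subsingleton.elim f (𝟙 q)]
    exact ConcreteCategory.congr_hom (G.map_id q) _
  · exact h _ _ hpq

/-- The natural transformation out of the constant presheaf of rank one attached to a section. -/
noncomputable def sectionHom [Small.{w} R] (G : Pᵒᵖ ⥤ ModuleCat.{w} R) {x : ∀ p, G.obj p}
    (hx : IsSection G x) :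
    (Functor.const Pᵒᵖ).obj (ModuleCat.of R (Shrink.{w} R)) ⟶ G where
  app p := ModuleCat.ofHom
    (LinearMap.toSpanSingleton R _ (x p) ∘ₗ (Shrink.linearEquiv R R).toLinearMap)
  naturality p q f := by
    refine ModuleCat.hom_ext (LinearMap.ext fun r ↦ ?_)
    rw [← hx f]
    exact (map_smul (G.map f).hom _ _).symm

theorem sectionHom_app_one [Small.{w} R] (G : Pᵒᵖ ⥤ ModuleCat.{w} R) {x : ∀ p, G.obj p}
    (hx : IsSection G x) (p : Pᵒᵖ) :
    (sectionHom G hx).app p ((Shrink.linearEquiv.{w} R R).symm 1) = x p := by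
  change (Shrink.linearEquiv R R) ((Shrink.linearEquiv.{w} R R).symm 1) • x p = x p
  rw [LinearEquiv.apply_symm_apply, one_smul]

/-- Sections of an injective presheaf over a lower set extend to global sections. -/
theorem exists_section_extension [Small.{w} R] {D : Set P} (hD : IsLowerSet D)
    (E : Pᵒᵖ ⥤ ModuleCat.{w} R) [Injective E] {x : ∀ q, ((presheafRestrict R D).obj E).obj q}
    (hx : IsSection ((presheafRestrict R D).obj E) x) :
    ∃ y : ∀ p, E.obj p, IsSection E y ∧ ∀ q : D, y (.op q.1) = x (.op q) := by
  obtain ⟨φ, hφ⟩ := exists_presheafRestrict_map_eq hD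
    (G := (Functor.const Pᵒᵖ).obj (ModuleCat.of R (Shrink.{w} R))) (sectionHom _ hx)
  refine ⟨fun p ↦ φ.app p ((Shrink.linearEquiv.{w} R R).symm 1), fun p q f ↦ ?_, fun q ↦ ?_⟩
  · exact (NatTrans.naturality_apply φ f _).symm
  · have := ConcreteCategory.congr_hom (congr_app hφ (.op q))
      ((Shrink.linearEquiv.{w} R R).symm 1)
    exact this.trans (sectionHom_app_one _ hx _)

variable [Small.{w} P]

theorem exists_limit_π_eq [Small.{w} R] (G : Pᵒᵖ ⥤ ModuleCat.{w} R) {x : ∀ p, G.obj p}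
    (hx : IsSection G x) :
    ∃ y : (lim.obj G : ModuleCat.{w} R), ∀ p, limit.π G p y = x p := by
  let c : Cone G := ⟨_, sectionHom G hx⟩
  refine ⟨limit.lift G c ((Shrink.linearEquiv.{w} R R).symm 1), fun p ↦ ?_⟩
  exact (ConcreteCategory.congr_hom (limit.lift_π c p) _).trans (sectionHom_app_one G hx p)

/-- Elements are morphisms from the free module of rank one, so uniqueness of maps into a limit
applies. -/
theorem limit_elem_ext [Small.{w} R] (G : Pᵒᵖ ⥤ ModuleCat.{w} R)
    {x y : (lim.obj G : ModuleCat.{w} R)} (h : ∀ p, limit.π G p x = limit.π G p y) : x = y := by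
  let S := ModuleCat.of R (Shrink.{w} R)
  let g (z : (lim.obj G : ModuleCat.{w} R)) : S ⟶ limit G :=
    ModuleCat.ofHom (LinearMap.toSpanSingleton R _ z ∘ₗ (Shrink.linearEquiv R R).toLinearMap)
  have hg (z) : (g z).hom ((Shrink.linearEquiv.{w} R R).symm 1) = z := by
    change (Shrink.linearEquiv R R) ((Shrink.linearEquiv.{w} R R).symm 1) • z = z
    rw [LinearEquiv.apply_symm_apply, one_smul]
  have : g x = g y := by
    refine limit.hom_ext fun p ↦ ModuleCat.hom_ext (LinearMap.ext fun r ↦ ?_)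
    refine (map_smul (limit.π G p).hom _ x).trans (Eq.trans ?_ (map_smul (limit.π G p).hom _ y).symm)
    exact congr_arg _ (h p)
  rw [← hg x, ← hg y, this]

theorem isSection_limit_π (G : Pᵒᵖ ⥤ ModuleCat.{w} R) (x : (lim.obj G : ModuleCat.{w} R)) :
    IsSection G fun p ↦ limit.π G p x :=
  fun _ _ f ↦ ConcreteCategory.congr_hom (limit.w G f) x

theorem limit_π_lim_map_apply {G H : Pᵒᵖ ⥤ ModuleCat.{w} R} (φ : G ⟶ H)
    (x : (lim.obj G : ModuleCat.{w} R)) (p : Pᵒᵖ) :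
    limit.π H p (lim.map φ x) = φ.app p (limit.π G p x) :=
  ConcreteCategory.congr_hom (limMap_π φ p) x

end Sections

/-! ### Well-founded gluing -/

section Recursion

/-- Over a well-founded order, if every compatible family of admissible elements below `p` extends
to an admissible element at `p`, then there is a globally compatible family of admissible
elements. -/
theorem exists_compatible_family {P : Type*} [PartialOrder P] [WellFoundedLT P] {X : P → Type*}
    [∀ p, Nonempty (X p)] (res : ∀ {p q : P}, q < p → X p → X q) (S : ∀ p, Set (X p))
    (H : ∀ (p : P) (t : ∀ q, q < p → X q), (∀ q hq, t q hq ∈ S q) →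
      (∀ q r (hq : q < p) (hr : r < q), res hr (t q hq) = t r (hr.trans hq)) →
      ∃ e ∈ S p, ∀ q hq, res hq e = t q hq) :
    ∃ t : ∀ p, X p, (∀ p, t p ∈ S p) ∧ ∀ p q (hq : q < p), res hq (t p) = t q := by
  classical
  let step (p : P) (t : ∀ q, q < p → X q) : X p :=
    -- The arbitrary default is never used: the induction below shows that the condition always
    -- holds.
    if h : ∃ e ∈ S p, ∀ q hq, res hq e = t q hq then h.choose else Classical.arbitrary _
  let t : ∀ p, X p := WellFoundedLT.fix step
  have ht (p : P) : t p ∈ S p ∧ ∀ q (hq : q < p), res hq (t p) = t q := by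
    induction p using WellFoundedLT.induction with
    | ind p ih =>
      have h := H p (fun q _ ↦ t q) (fun q hq ↦ (ih q hq).1) fun q r hq hr ↦ (ih q hq).2 r hr
      have htp : t p = h.choose := (WellFoundedLT.fix_eq step p).trans (dif_pos h)
      rw [htp]
      exact h.choose_spec
  exact ⟨t, fun p ↦ (ht p).1, fun p ↦ (ht p).2⟩

end Recursion

/-! ### Higher limits through injective resolutions -/

section Resolution

/-- An exact functor which preserves injective objects maps injective resolutions to injective
resolutions. -/
@[simps cocomplex]
noncomputable def mapInjectiveResolution {C : Type*} [Category* C] [Abelian C] {D : Type*}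
    [Category* D] [Abelian D] (F : C ⥤ D) [F.Additive] [F.PreservesInjectiveObjects]
    [F.PreservesHomology] {Z : C} (I : InjectiveResolution Z) :
    InjectiveResolution (F.obj Z) where
  cocomplex := (F.mapHomologicalComplex _).obj I.cocomplex
  injective n := F.injective_obj_of_injective (I.injective n)
  ι := (HomologicalComplex.singleMapHomologicalComplex _ _ _).inv.app _ ≫
    (F.mapHomologicalComplex _).map I.ι
  quasiIso := inferInstance

variable {P : Type v} [PartialOrder P] {R : Type u} [CommRing R]

theorem presheafRestrict_preservesInjectiveObjects {D : Set P} (hD : IsLowerSet D) :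
    (presheafRestrict.{w} R D).PreservesInjectiveObjects :=
  Functor.preservesInjectiveObjects_of_adjunction_of_preservesMonomorphisms
    (extendByZeroAdjunction R hD)

/-- Restriction of an injective resolution to a lower set. -/
noncomputable def restrictInjectiveResolution {D : Set P} (hD : IsLowerSet D)
    {F : Pᵒᵖ ⥤ ModuleCat.{w} R} (I : InjectiveResolution F) :
    InjectiveResolution ((presheafRestrict R D).obj F) :=
  have := presheafRestrict_preservesInjectiveObjects.{w} (R := R) hD
  mapInjectiveResolution (presheafRestrict R D) I

/-- Evaluation at `p` is exact. -/
theorem exists_d_app_eq {F : Pᵒᵖ ⥤ ModuleCat.{w} R}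
    (I : InjectiveResolution F) (k : ℕ) (p : Pᵒᵖ) (z : (I.cocomplex.X (k + 1)).obj p)
    (hz : (I.cocomplex.d (k + 1) (k + 2)).app p z = 0) :
    ∃ e, (I.cocomplex.d k (k + 1)).app p e = z :=
  (ShortComplex.moduleCat_exact_iff _).1
    ((I.exact_succ k).map ((evaluation Pᵒᵖ (ModuleCat.{w} R)).obj p)) z hz

variable [Small.{w} P] [Small.{w} R] {F : Pᵒᵖ ⥤ ModuleCat.{w} R}

theorem subsingleton_higherLimit_iff_exactAt (I : InjectiveResolution F) (k : ℕ) :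
    Subsingleton (higherLimit F k) ↔
      (((lim : (Pᵒᵖ ⥤ ModuleCat.{w} R) ⥤ ModuleCat.{w} R).mapHomologicalComplex _).obj
        I.cocomplex).ExactAt k := by
  rw [HomologicalComplex.exactAt_iff_isZero_homology, ← ModuleCat.isZero_iff_subsingleton]
  exact (I.isoRightDerivedObj lim k).isZero_iff

theorem eq_zero_of_subsingleton_higherLimit_zero (I : InjectiveResolution F)
    (h : Subsingleton (higherLimit F 0)) {x : ∀ p, (I.cocomplex.X 0).obj p}
    (hx : IsSection _ x) (hdx : ∀ p, (I.cocomplex.d 0 1).app p (x p) = 0) (p : Pᵒᵖ) :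
    x p = 0 := by
  -- The predecessor of degree 0 is 0 itself, with `d 0 0 = 0`, so exactness says that cocycles
  -- vanish.
  rw [subsingleton_higherLimit_iff_exactAt I, HomologicalComplex.exactAt_iff' _ 0 0 1 (by simp)
    (by simp), ShortComplex.moduleCat_exact_iff] at h
  obtain ⟨y, hy⟩ := exists_limit_π_eq _ hx
  have hdy : lim.map (I.cocomplex.d 0 1) y = 0 := limit_elem_ext _ fun p ↦ by
    rw [limit_π_lim_map_apply, hy, hdx, map_zero]
  obtain ⟨z, hz⟩ := h y hdy
  have hd : lim.map (I.cocomplex.d 0 0) z = y := hz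
  rw [I.cocomplex.shape 0 0 (by simp), Functor.map_zero] at hd
  rw [← hy, ← hd]
  exact map_zero _

theorem subsingleton_higherLimit_succ_iff (I : InjectiveResolution F) (k : ℕ) :
    Subsingleton (higherLimit F (k + 1)) ↔
      ∀ x : ∀ p, (I.cocomplex.X (k + 1)).obj p, IsSection _ x →
        (∀ p, (I.cocomplex.d (k + 1) (k + 2)).app p (x p) = 0) →
        ∃ y : ∀ p, (I.cocomplex.X k).obj p, IsSection _ y ∧
          ∀ p, (I.cocomplex.d k (k + 1)).app p (y p) = x p := by
  rw [subsingleton_higherLimit_iff_exactAt I, HomologicalComplex.exactAt_iff' _ k (k + 1) (k + 2)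
    (by simp) (by simp only [CochainComplex.next]; rfl), ShortComplex.moduleCat_exact_iff]
  constructor
  · intro h x hx hdx
    obtain ⟨x', hx'⟩ := exists_limit_π_eq _ hx
    have hdx' : lim.map (I.cocomplex.d (k + 1) (k + 2)) x' = 0 := limit_elem_ext _ fun p ↦ by
      rw [limit_π_lim_map_apply, hx', hdx, map_zero]
    obtain ⟨y, hy⟩ := h x' hdx'
    refine ⟨_, isSection_limit_π _ y, fun p ↦ ?_⟩
    rw [← hx', ← hy]
    exact (limit_π_lim_map_apply _ _ _).symm
  · intro h (x : (lim.obj (I.cocomplex.X (k + 1)) : ModuleCat.{w} R)) hx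
    have hx' : lim.map (I.cocomplex.d (k + 1) (k + 2)) x = 0 := hx
    obtain ⟨y, hy, hdy⟩ := h _ (isSection_limit_π _ x) fun p ↦ by
      rw [← limit_π_lim_map_apply, hx', map_zero]
    obtain ⟨y', hy'⟩ := exists_limit_π_eq _ hy
    refine ⟨y', limit_elem_ext _ fun p ↦ (limit_π_lim_map_apply _ _ _).trans ?_⟩
    rw [hy', hdy]

/-- If the `k`-th higher limits over all `P_{<p}` vanish, cocycles of degree `k` of an injective
resolution extend from `P_{<p}` to `p`. -/
theorem exists_cocycle_extension (I : InjectiveResolution F) (k : ℕ) (p : P)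
    (h : Subsingleton (higherLimit (restrictIio F p) k))
    {u : ∀ q, ((presheafRestrict R (Set.Iio p)).obj (I.cocomplex.X k)).obj q}
    (hu : IsSection ((presheafRestrict R (Set.Iio p)).obj (I.cocomplex.X k)) u)
    (hdu : ∀ q : Set.Iio p, (I.cocomplex.d k (k + 1)).app (.op q.1) (u (.op q)) = 0) :
    ∃ u' : (I.cocomplex.X k).obj (.op p), (I.cocomplex.d k (k + 1)).app (.op p) u' = 0 ∧
      ∀ q (hq : q < p), (I.cocomplex.X k).map (homOfLE hq.le).op u' = u (.op ⟨q, hq⟩) := by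
  let J := restrictInjectiveResolution (isLowerSet_Iio p) I
  cases k with
  | zero =>
    refine ⟨0, map_zero _, fun q hq ↦ (map_zero _).trans ?_⟩
    exact (eq_zero_of_subsingleton_higherLimit_zero J h hu (fun q ↦ hdu q.unop)
      (.op ⟨q, hq⟩)).symm
  | succ k =>
    obtain ⟨v, hv, hdv⟩ := (subsingleton_higherLimit_succ_iff J k).1 h u hu fun q ↦ hdu q.unop
    -- The cocycle `u` itself need not extend as a section of the kernel, but its primitive `v` does
    -- extend; the differential of that extension is the cocycle sought.
    obtain ⟨y, hy, hyv⟩ := exists_section_extension (isLowerSet_Iio p) (I.cocomplex.X k) hv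
    refine ⟨(I.cocomplex.d k (k + 1)).app (.op p) (y (.op p)), ?_, fun q hq ↦ ?_⟩
    · exact ConcreteCategory.congr_hom (congr_app (I.cocomplex.d_comp_d k (k + 1) (k + 2)) _) _
    · refine ((hy.map _) _).trans ?_
      refine Eq.trans ?_ (hdv (.op ⟨q, hq⟩))
      exact congr_arg _ (hyv ⟨q, hq⟩)

/-- Over a well-founded poset, vanishing of the `k`-th higher limits over all `P_{<p}` forces
vanishing of the higher limit of degree `k + 1`. -/
theorem subsingleton_higherLimit_succ [WellFoundedLT P] (k : ℕ)
    (h : ∀ p : P, Subsingleton (higherLimit (restrictIio F p) k)) :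
    Subsingleton (higherLimit F (k + 1)) := by
  let I := injectiveResolution F
  rw [subsingleton_higherLimit_succ_iff I]
  intro z hz hdz
  let d := I.cocomplex.d k (k + 1)
  obtain ⟨t, ht, hres⟩ := exists_compatible_family (X := fun p ↦ (I.cocomplex.X k).obj (.op p))
    (fun hq ↦ (I.cocomplex.X k).map (homOfLE hq.le).op)
    (fun p ↦ {e | d.app (.op p) e = z (.op p)}) fun p t ht hres ↦ by
      obtain ⟨e, he⟩ := exists_d_app_eq I k (.op p) (z (.op p)) (hdz _)
      -- The failure of `e` to restrict to `t`: a cocycle, since both have differential `z`.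
      let u (q : (Set.Iio p)ᵒᵖ) : (I.cocomplex.X k).obj (.op q.unop.1) :=
        (I.cocomplex.X k).map (homOfLE q.unop.2.le).op e - t q.unop.1 q.unop.2
      have hu : IsSection ((presheafRestrict R (Set.Iio p)).obj (I.cocomplex.X k)) u :=
        isSection_of_lt fun q r hr ↦ by
          refine (map_sub ((I.cocomplex.X k).map
            (homOfLE (show r.1 ≤ q.1 from hr.le)).op).hom _ _).trans ?_
          refine congr_arg₂ _ ?_ (hres q.1 r.1 q.2 hr)
          exact (ConcreteCategory.congr_hom ((I.cocomplex.X k).map_comp (homOfLE (show q.1 ≤ p from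
            q.2.le)).op (homOfLE (show r.1 ≤ q.1 from hr.le)).op) e).symm
      have hdu (q : Set.Iio p) : d.app (.op q.1) (u (.op q)) = 0 := by
        refine (map_sub (d.app (.op q.1)).hom _ _).trans (sub_eq_zero.2 ?_)
        refine (NatTrans.naturality_apply d (homOfLE q.2.le).op e).trans ?_
        exact ((congr_arg _ he).trans (hz _)).trans (ht q.1 q.2).symm
      obtain ⟨u', hdu', hu'⟩ := exists_cocycle_extension I k p (h p) hu hdu
      refine ⟨e - u', ?_, fun q hq ↦ ?_⟩
      · refine (map_sub (d.app (.op p)).hom _ _).trans ?_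
        exact (congr_arg₂ _ he hdu').trans (sub_zero _)
      · refine (map_sub ((I.cocomplex.X k).map (homOfLE hq.le).op).hom _ _).trans ?_
        exact (congr_arg _ (hu' q hq)).trans (sub_sub_cancel _ _)
  exact ⟨fun p ↦ t p.unop, isSection_of_lt hres, fun p ↦ ht p.unop⟩

end Resolution

theorem mainTheorem4 {P : Type v} [PartialOrder P] [Small.{w} P]
    (hP : IsFilteredPoset P)
    {R : Type u} [CommRing R] [Small.{w} R]
    (F : Pᵒᵖ ⥤ ModuleCat.{w} R) (n : ℕ)
    (h : ∀ p : P, ∀ k : ℕ, n ≤ k → Subsingleton (higherLimit (restrictIio F p) k)) :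
    ∀ k : ℕ, n < k → Subsingleton (higherLimit F k) := by
  obtain ⟨d, hd⟩ := hP
  -- The degree map serves only to give well-foundedness.
  have : WellFoundedLT P := hd.wellFoundedLT
  rintro (_ | k) hk
  · omega
  · exact subsingleton_higherLimit_succ k fun p ↦ h p k (by omega)
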